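/- Let $\alpha$ be any set (in particular, any ordinal). A (non-commutative) cylindric-polyadic equality algebra of dimension $\alpha$ is an algebra $\langle A,+,\cdot,-,0,1,c_i,s_\tau,d_{ij}\rangle_{i,j\in\alpha,\ \tau\in{}^{\alpha}\alpha}$ in which $\langle A,+,\cdot,-,0,1\rangle$ is a Boolean algebra, the $c_i$ and $s_\tau$ are unary operations, the $d_{ij}$ are constants, and for all $x,y\in A$, $i,j\in\alpha$ and $\sigma,\tau\in{}^{\alpha}\alpha$: 1. $c_i0=0$, $\ x\le c_ix$, $\ c_i(x\cdot c_iy)=c_ix\cdot c_iy$; 2. $s_{\mathrm{Id}}x=x$, $\ s_\sigma s_\tau x=s_{\sigma\circ\tau}x$, $\ s_\sigma(x+y)=s_\sigma x+s_\sigma y$, $\ s_\sigma(-x)=-s_\sigma x$; 3. $s_\sigma c_ix=s_\tau c_ix$ whenever $\sigma(k)=\tau(k)$ for all $k\ne i$; 4. $c_is_\sigma x\le s_\sigma c_jx$ if $\sigma^{-1}\{i\}=\{j\}$, with equality if moreover $\sigma$ is a permutation of $\alpha$; and $c_is_\sigma x=s_\sigma x$ if $\sigma^{-1}\{i\}=\emptyset$;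 5. $d_{ii}=1$, $\ x\cdot d_{ij}\le s_{[i/j]}x$, $\ s_\tau d_{ij}=d_{\tau(i)\tau(j)}$, where $[i/j]$ sends $i$ to $j$ and fixes every other element of $\alpha$. Let $\mathsf{CPEA}_\alpha$ be the variety of these algebras. **Theorem.** For every $\alpha$, the variety $\mathsf{CPEA}_\alpha$ has the superamalgamation property: whenever $A,B,C\in\mathsf{CPEA}_\alpha$ and $f:A\to B$, $h:A\to C$ are injective homomorphisms, there are $D\in\mathsf{CPEA}_\alpha$ and injective homomorphisms $m:B\to D$, $n:C\to D$ with $m\circ f=n\circ h$ such that, for all $x\in B$ and $y\in C$, if $m(x)\le n(y)$ then there is $a\in A$ with $x\le f(a)$ and $h(a)\le y$, and if $n(y)\le m(x)$ then there is $a\in A$ with $y\le h(a)$ and $f(a)\le x$. -/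

import Mathlib

universe u v

namespace CylPoly

open Classical in
/-- The replacement `[i/j]`: it sends `i` to `j` and fixes everything else. -/
noncomputable def replacement {α : Type v} (i j : α) : α → α :=
  Function.update id i j

/-- A (non-commutative) cylindric-polyadic equality algebra of dimension `α` on a Boolean
algebra `A`: finitary cylindrifications `c i`, a substitution operator `s τ` for every
transformation `τ` of `α`, and diagonal elements `d i j`.  Cylindrifications are not assumed to
commute with each other, and the polyadic law `c i (s σ x) = s σ (c j x)` for
`σ⁻¹{i} = {j}` is only an inequality, unless `σ` is a permutation. -/
class CPEA (α : Type v) (A : Type u) [BooleanAlgebra A] where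
  /-- cylindrification -/
  c : α → A → A
  /-- substitution -/
  s : (α → α) → A → A
  /-- diagonal elements -/
  d : α → α → A
  c_bot : ∀ i, c i ⊥ = ⊥
  le_c : ∀ i x, x ≤ c i x
  c_inf_c : ∀ i x y, c i (x ⊓ c i y) = c i x ⊓ c i y
  s_id : ∀ x, s id x = x
  s_s : ∀ σ τ x, s σ (s τ x) = s (σ ∘ τ) x
  s_sup : ∀ σ x y, s σ (x ⊔ y) = s σ x ⊔ s σ y
  s_compl : ∀ σ x, s σ xᶜ = (s σ x)ᶜ
  s_c_congr : ∀ σ τ i x, (∀ k, k ≠ i → σ k = τ k) → s σ (c i x) = s τ (c i x)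
  c_s_le : ∀ σ i j x, σ ⁻¹' {i} = {j} → c i (s σ x) ≤ s σ (c j x)
  c_s_empty : ∀ σ i x, σ ⁻¹' {i} = ∅ → c i (s σ x) = s σ x
  c_s_perm : ∀ σ i j x, Function.Bijective σ → σ ⁻¹' {i} = {j} → c i (s σ x) = s σ (c j x)
  d_self : ∀ i, d i i = ⊤
  inf_d_le : ∀ i j x, x ⊓ d i j ≤ s (replacement i j) x
  s_d : ∀ τ i j, s τ (d i j) = d (τ i) (τ j)

/-- Homomorphisms of cylindric-polyadic equality algebras: Boolean homomorphisms (a bounded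
lattice homomorphism between Boolean algebras preserves complements) that preserve all
cylindrifications, substitutions and diagonal elements. -/
structure CPEAHom (α : Type v) (A B : Type u) [BooleanAlgebra A] [BooleanAlgebra B]
    [CPEA α A] [CPEA α B] extends BoundedLatticeHom A B where
  map_c : ∀ (i : α) (x : A), toFun (CPEA.c i x) = CPEA.c i (toFun x)
  map_s : ∀ (τ : α → α) (x : A), toFun (CPEA.s τ x) = CPEA.s τ (toFun x)
  map_d : ∀ i j : α, toFun (CPEA.d i j) = CPEA.d i j

/-- The superamalgamation property of the variety of cylindric-polyadic equality algebras of
dimension `α`: every pair of embeddings `f : A → B`, `h : A → C` has an amalgam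
`m : B → D`, `n : C → D` (embeddings with `m ∘ f = n ∘ h`) in the variety, such that every
inequality in `D` between an element of `B` and an element of `C` is interpolated in `A`. -/
def HasSUPAP (α : Type v) : Prop :=
  ∀ (A B C : Type u) [BooleanAlgebra A] [BooleanAlgebra B] [BooleanAlgebra C]
    [CPEA α A] [CPEA α B] [CPEA α C] (f : CPEAHom α A B) (h : CPEAHom α A C),
    Function.Injective f.toFun → Function.Injective h.toFun →
    ∃ (D : Type u) (_ : BooleanAlgebra D) (_ : CPEA α D)
      (m : CPEAHom α B D) (n : CPEAHom α C D),
      Function.Injective m.toFun ∧ Function.Injective n.toFun ∧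
      (∀ a : A, m.toFun (f.toFun a) = n.toFun (h.toFun a)) ∧
      (∀ (x : B) (y : C), m.toFun x ≤ n.toFun y →
        ∃ a : A, x ≤ f.toFun a ∧ h.toFun a ≤ y) ∧
      (∀ (x : B) (y : C), n.toFun y ≤ m.toFun x →
        ∃ a : A, y ≤ h.toFun a ∧ f.toFun a ≤ x)

end CylPoly

/-! By Stone duality, embeddings of `A` into `B` and `C` become surjections of canonical frames. The
amalgam is the complex algebra of the pullback, the set of pairs of points of `B` and `C` with the
same restriction to `A`. The pullback is again a frame because every frame condition is universal
Horn, so it passes to pairs coordinatewise. This is where non-commutativity matters: commuting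
cylindrifications would need an existential condition, which pullbacks need not inherit. The
inequality in axiom 4 only needs `r_act`, and equality for permutations then comes from the inverse.
The projections preserve cylindrifications because duals of homomorphisms satisfy the back condition
(`exists_r_dual_eq`), and injectivity follows from surjectivity of the duals. If `x` and `y` have no
interpolant, some point of `A` lifts both to a point containing `x` and to one omitting `y`; this
pair refutes the inequality in the amalgam (`exists_interpolant`). -/

namespace CylPoly

/-! ### Stone duality for Boolean algebras -/

section Points

variable {A B : Type u} [BooleanAlgebra A] [BooleanAlgebra B]

/-- The points of the Stone space of a Boolean algebra, as homomorphisms to `Prop`. -/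
abbrev Point (A : Type u) [BooleanAlgebra A] : Type u := BoundedLatticeHom A Prop

namespace Point

theorem map_inf_iff (u : Point A) (x y : A) : u (x ⊓ y) ↔ u x ∧ u y := by
  rw [map_inf]; rfl

theorem map_sup_iff (u : Point A) (x y : A) : u (x ⊔ y) ↔ u x ∨ u y := by
  rw [map_sup]; rfl

theorem map_top_iff (u : Point A) : u ⊤ := by
  rw [map_top]; trivial

theorem not_map_bot (u : Point A) : ¬ u ⊥ := by
  rw [map_bot]; exact id

theorem mono (u : Point A) {x y : A} (hxy : x ≤ y) (hx : u x) : u y :=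
  OrderHomClass.mono u hxy hx

theorem map_compl_iff (u : Point A) (x : A) : u xᶜ ↔ ¬ u x := by
  rw [map_compl']; rfl

/-- Points are ultrafilters, hence maximal: an inclusion between two of them is an equality. -/
theorem ext_of_imp {u v : Point A} (huv : ∀ x, u x → v x) : u = v := by
  ext x
  refine ⟨huv x, fun hv => ?_⟩
  by_contra hu
  exact (v.map_compl_iff x).1 (huv _ ((u.map_compl_iff x).2 hu)) hv

/-- The point given by the complement of a prime ideal. -/
def ofPrimeIdeal (J : Order.Ideal A) (hJ : J.IsPrime) : Point A where
  toFun x := x ∉ J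
  map_sup' x y := by
    refine propext ?_
    rw [Order.Ideal.sup_mem_iff, not_and_or]
    rfl
  map_inf' x y := by
    refine propext ⟨fun hxy => ⟨fun hx => hxy (J.lower inf_le_left hx),
      fun hy => hxy (J.lower inf_le_right hy)⟩, fun hxy hmem => ?_⟩
    exact (hJ.mem_or_mem hmem).elim hxy.1 hxy.2
  map_top' := eq_true hJ.top_notMem
  map_bot' := eq_false (not_not.2 J.bot_mem)

/-- A filter and an ideal (given by closure conditions) that are disjoint are separated by
a point. -/
theorem exists_separating (F I : Set A) (hFtop : ⊤ ∈ F) (hFup : ∀ x y, x ≤ y → x ∈ F → y ∈ F)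
    (hFinf : ∀ x y, x ∈ F → y ∈ F → x ⊓ y ∈ F)
    (hIbot : ⊥ ∈ I) (hIlow : ∀ x y, x ≤ y → y ∈ I → x ∈ I)
    (hIsup : ∀ x y, x ∈ I → y ∈ I → x ⊔ y ∈ I) (hFI : ∀ x, x ∈ F → x ∉ I) :
    ∃ u : Point A, (∀ x ∈ F, u x) ∧ ∀ x ∈ I, ¬ u x := by
  have hF : Order.IsPFilter F := Order.IsPFilter.of_def ⟨⊤, hFtop⟩
    (fun x hx y hy => ⟨x ⊓ y, hFinf x y hx hy, inf_le_left, inf_le_right⟩)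
    (fun {x y} hxy hx => hFup x y hxy hx)
  have hI : Order.IsIdeal I :=
    ⟨fun x y hyx hx => hIlow y x hyx hx, ⟨⊥, hIbot⟩,
      fun x hx y hy => ⟨x ⊔ y, hIsup x y hx hy, le_sup_left, le_sup_right⟩⟩
  obtain ⟨J, hJ, hIJ, hFJ⟩ := DistribLattice.prime_ideal_of_disjoint_filter_ideal
    (F := hF.toPFilter) (I := hI.toIdeal) (Set.disjoint_left.2 hFI)
  exact ⟨ofPrimeIdeal J hJ, fun x hx hxJ => Set.disjoint_left.1 hFJ hx hxJ,
    fun x hx hxJ => hxJ (hIJ hx)⟩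

/-- A point `w` of `A` lifts along `f : A → B` to a point of `B` containing a given filter, as soon
as every `a` with `f a` in the filter belongs to `w`. -/
theorem exists_lift (f : BoundedLatticeHom A B) (w : Point A) (F : Set B) (hFtop : ⊤ ∈ F)
    (hFup : ∀ x y, x ≤ y → x ∈ F → y ∈ F) (hFinf : ∀ x y, x ∈ F → y ∈ F → x ⊓ y ∈ F)
    (hFw : ∀ a, f a ∈ F → w a) :
    ∃ u : Point B, (∀ x ∈ F, u x) ∧ u.comp f = w := by
  -- A point avoiding the ideal generated by the images of elements outside `w` restricts to a point
  -- below `w`, hence to `w`.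
  obtain ⟨u, huF, huI⟩ := exists_separating F {b | ∃ a, ¬ w a ∧ b ≤ f a} hFtop hFup hFinf
    ⟨⊥, w.not_map_bot, bot_le⟩ (fun x y hxy ⟨a, ha, hya⟩ => ⟨a, ha, hxy.trans hya⟩)
    (fun x y ⟨a, ha, hxa⟩ ⟨b, hb, hyb⟩ => ⟨a ⊔ b, by rw [w.map_sup_iff]; tauto, by
      rw [map_sup]; exact sup_le_sup hxa hyb⟩)
    (fun x hx ⟨a, ha, hxa⟩ => ha (hFw a (hFup x _ hxa hx)))
  refine ⟨u, huF, ext_of_imp fun a hua => ?_⟩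
  by_contra hwa
  exact huI (f a) ⟨a, hwa, le_rfl⟩ hua

/-- Lifting a point along `f` to a point containing `x`. -/
theorem exists_lift_mem (f : BoundedLatticeHom A B) (w : Point A) (x : B)
    (hxw : ∀ a, x ≤ f a → w a) : ∃ u : Point B, u x ∧ u.comp f = w := by
  obtain ⟨u, hux, huw⟩ := exists_lift f w (Set.Ici x) le_top
    (fun y z hyz hxy => le_trans hxy hyz) (fun y z hxy hxz => le_inf hxy hxz) hxw
  exact ⟨u, hux x le_rfl, huw⟩

/-- The dual of an embedding is surjective. -/
theorem exists_lift_of_injective (f : BoundedLatticeHom A B) (hf : Function.Injective f)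
    (w : Point A) : ∃ u : Point B, u.comp f = w := by
  obtain ⟨u, -, huw⟩ := exists_lift_mem f w ⊤ fun a ha => by
    have : a = ⊤ := hf (by rw [map_top]; exact top_le_iff.1 ha)
    rw [this]
    exact w.map_top_iff
  exact ⟨u, huw⟩

/-- The points of a Boolean algebra determine its order. -/
theorem exists_mem_of_not_le {x y : A} (hxy : ¬ x ≤ y) : ∃ u : Point A, u x ∧ ¬ u y := by
  obtain ⟨u, hux, huy⟩ := exists_separating (Set.Ici x) (Set.Iic y) le_top
    (fun _ _ hyz hxy => le_trans hxy hyz) (fun _ _ hxy hxz => le_inf hxy hxz) bot_le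
    (fun _ _ hyz hzy => le_trans hyz hzy) (fun _ _ h₁ h₂ => sup_le h₁ h₂)
    (fun z hxz hzy => hxy (le_trans hxz hzy))
  exact ⟨u, hux x le_rfl, huy y le_rfl⟩

/-- Points of two algebras over `A` agreeing on `A` separate `x` from `y`, unless an element of `A`
interpolates between `x` and `y`. -/
theorem exists_interpolant {C : Type u} [BooleanAlgebra C] (f : BoundedLatticeHom A B)
    (h : BoundedLatticeHom A C) (x : B) (y : C)
    (hxy : ∀ (u : Point B) (v : Point C), u.comp f = v.comp h → u x → v y) :
    ∃ a : A, x ≤ f a ∧ h a ≤ y := by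
  by_contra! hno
  -- Without an interpolant, the filter of elements above `x` and the ideal of elements below `y`
  -- are disjoint in `A`.
  obtain ⟨w, hwF, hwI⟩ := exists_separating {a | x ≤ f a} {a | h a ≤ y} (by simp)
    (fun a b hab hxa => le_trans hxa (OrderHomClass.mono f hab))
    (fun a b hxa hxb => by
      change x ≤ f (a ⊓ b)
      rw [map_inf]; exact le_inf hxa hxb) (by simp)
    (fun a b hab hby => le_trans (OrderHomClass.mono h hab) hby)
    (fun a b hay hby => by
      change h (a ⊔ b) ≤ y
      rw [map_sup]; exact sup_le hay hby) hno
  obtain ⟨u, hux, huw⟩ := exists_lift_mem f w x hwF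
  obtain ⟨v, hvy, hvw⟩ := exists_lift_mem h w yᶜ fun a hya => by
    by_contra hwa
    refine hwI aᶜ ?_ ((w.map_compl_iff a).2 hwa)
    change h aᶜ ≤ y
    rw [map_compl']
    exact compl_le_iff_compl_le.1 hya
  exact (v.map_compl_iff y).1 hvy (hxy u v (huw.trans hvw.symm) hux)

end Point

end Points

/-! ### Frames and their complex algebras -/

/-- Relational structures whose complex algebras are cylindric-polyadic equality algebras:
equivalence relations `r i`, a right action of the monoid of transformations, and
unary predicates `e i j`. -/
structure Frame (α : Type v) (X : Type u) where
  /-- accessibility for cylindrification -/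
  r : α → X → X → Prop
  /-- action of transformations -/
  act : (α → α) → X → X
  /-- diagonals -/
  e : α → α → X → Prop
  r_equiv : ∀ i, Equivalence (r i)
  act_id : ∀ x, act id x = x
  act_comp : ∀ σ τ x, act (σ ∘ τ) x = act τ (act σ x)
  r_act_congr : ∀ σ τ i x, (∀ k, k ≠ i → σ k = τ k) → r i (act σ x) (act τ x)
  r_act : ∀ σ i j x y, σ ⁻¹' {i} = {j} → r i x y → r j (act σ x) (act σ y)
  act_eq : ∀ σ i x y, σ ⁻¹' {i} = ∅ → r i x y → act σ x = act σ y
  e_self : ∀ i x, e i i x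
  act_replacement : ∀ i j x, e i j x → act (replacement i j) x = x
  e_act : ∀ τ i j x, e i j (act τ x) ↔ e (τ i) (τ j) x

namespace Frame

variable {α : Type v} {X : Type u} (𝔉 : Frame α X)

/-- Cylindrification in the complex algebra. -/
def cyl (i : α) (S : Set X) : Set X := {x | ∃ y, 𝔉.r i x y ∧ y ∈ S}

theorem cyl_act_subset (σ : α → α) (i j : α) (S : Set X) (hσ : σ ⁻¹' {i} = {j}) :
    𝔉.cyl i (𝔉.act σ ⁻¹' S) ⊆ 𝔉.act σ ⁻¹' 𝔉.cyl j S :=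
  fun _ ⟨y, hxy, hy⟩ => ⟨𝔉.act σ y, 𝔉.r_act σ i j _ y hσ hxy, hy⟩

/-- The inverse `τ` of `σ` acts as the inverse of `act σ` and satisfies `τ ⁻¹' {j} = {i}`, so
`r_act` for `τ` pulls a witness back. -/
theorem act_cyl_subset (σ : α → α) (i j : α) (S : Set X) (hbij : Function.Bijective σ)
    (hσ : σ ⁻¹' {i} = {j}) : 𝔉.act σ ⁻¹' 𝔉.cyl j S ⊆ 𝔉.cyl i (𝔉.act σ ⁻¹' S) := by
  obtain ⟨τ, hτσ, hστ⟩ := Function.bijective_iff_has_inverse.1 hbij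
  have hj : σ j = i := by
    have : j ∈ σ ⁻¹' {i} := hσ ▸ rfl
    exact this
  have hτ : τ ⁻¹' {j} = {i} := by
    ext k
    simp only [Set.mem_preimage, Set.mem_singleton_iff]
    exact ⟨fun hk => by rw [← hj, ← hk, hστ], fun hk => by rw [hk, ← hj, hτσ]⟩
  have hact : ∀ x, 𝔉.act τ (𝔉.act σ x) = x := fun x => by
    rw [← 𝔉.act_comp, hστ.comp_eq_id, 𝔉.act_id]
  have hact' : ∀ x, 𝔉.act σ (𝔉.act τ x) = x := fun x => by
    rw [← 𝔉.act_comp, hτσ.comp_eq_id, 𝔉.act_id]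
  rintro x ⟨y, hxy, hy⟩
  refine ⟨𝔉.act τ y, ?_, ?_⟩
  · simpa only [hact] using 𝔉.r_act τ j i _ y hτ hxy
  · change 𝔉.act σ (𝔉.act τ y) ∈ S
    rwa [hact']

/-- The complex algebra of a frame. -/
abbrev complexAlgebra : CPEA α (Set X) where
  c := 𝔉.cyl
  s σ S := 𝔉.act σ ⁻¹' S
  d i j := {x | 𝔉.e i j x}
  c_bot i := Set.eq_empty_of_forall_notMem fun _ ⟨_, _, hy⟩ => hy
  le_c i S x hx := ⟨x, (𝔉.r_equiv i).refl x, hx⟩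
  c_inf_c i S T := by
    refine Set.Subset.antisymm ?_ ?_
    · rintro x ⟨y, hxy, hyS, z, hyz, hz⟩
      exact ⟨⟨y, hxy, hyS⟩, z, (𝔉.r_equiv i).trans hxy hyz, hz⟩
    · rintro x ⟨⟨y, hxy, hyS⟩, z, hxz, hz⟩
      exact ⟨y, hxy, hyS, z, (𝔉.r_equiv i).trans ((𝔉.r_equiv i).symm hxy) hxz, hz⟩
  s_id S := by ext x; simp only [Set.mem_preimage, 𝔉.act_id]
  s_s σ τ S := by ext x; simp only [Set.mem_preimage, 𝔉.act_comp]
  s_sup _ _ _ := rfl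
  s_compl _ _ := rfl
  s_c_congr σ τ i S hστ := by
    ext x
    have hr := 𝔉.r_act_congr σ τ i x hστ
    exact ⟨fun ⟨y, hy, hyS⟩ => ⟨y, (𝔉.r_equiv i).trans ((𝔉.r_equiv i).symm hr) hy, hyS⟩,
      fun ⟨y, hy, hyS⟩ => ⟨y, (𝔉.r_equiv i).trans hr hy, hyS⟩⟩
  c_s_le := 𝔉.cyl_act_subset
  c_s_empty σ i S hσ := by
    ext x
    refine ⟨fun ⟨y, hxy, hy⟩ => ?_, fun hx => ⟨x, (𝔉.r_equiv i).refl x, hx⟩⟩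
    rw [Set.mem_preimage, 𝔉.act_eq σ i x y hσ hxy]
    exact hy
  c_s_perm σ i j S hbij hσ :=
    Set.Subset.antisymm (𝔉.cyl_act_subset σ i j S hσ) (𝔉.act_cyl_subset σ i j S hbij hσ)
  d_self i := Set.eq_univ_of_forall (𝔉.e_self i)
  inf_d_le i j S := by
    rintro x ⟨hxS, hx⟩
    rw [Set.mem_preimage, 𝔉.act_replacement i j x hx]
    exact hxS
  s_d τ i j := by ext x; exact 𝔉.e_act τ i j x

end Frame

/-! ### Canonical frames -/

namespace CPEA

variable {α : Type v} {A : Type u} [BooleanAlgebra A] [CPEA α A]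

theorem c_c (i : α) (x : A) : c i (c i x) = c i x := by
  have := c_inf_c i ⊤ x
  rwa [top_inf_eq, top_le_iff.1 (le_c i (⊤ : A)), top_inf_eq] at this

/-- The cylindrification of `(c i x)ᶜ` is disjoint from `c i x`, since `c_inf_c` reduces their meet
to `c i ⊥`. -/
theorem c_compl_c (i : α) (x : A) : c i (c i x)ᶜ = (c i x)ᶜ := by
  refine le_antisymm (le_compl_iff_disjoint_right.2 (disjoint_iff.2 ?_)) (le_c i _)
  rw [← c_inf_c, compl_inf_eq_bot, c_bot]

theorem s_c_closed (σ : α → α) (i j : α) (x : A) (hσ : σ ⁻¹' {i} = {j}) :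
    c i (s σ (c j x)) = s σ (c j x) := by
  refine le_antisymm ?_ (le_c i _)
  have := c_s_le σ i j (c j x) hσ
  rwa [c_c] at this

/-- Substitutions are Boolean endomorphisms. -/
def sHom (A : Type u) [BooleanAlgebra A] [CPEA α A] (σ : α → α) : BoundedLatticeHom A A where
  toFun := s σ
  map_sup' := s_sup σ
  map_inf' x y := by
    rw [← compl_inj_iff, ← s_compl, compl_inf, s_sup, s_compl, s_compl, compl_inf]
  map_top' := by
    have h : s σ (⊤ : A) = s σ (⊤ ⊔ ⊤ᶜ) := by rw [sup_compl_eq_top]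
    rw [h, s_sup, s_compl, sup_compl_eq_top]
  map_bot' := by
    have h : s σ (⊥ : A) = (s σ ⊥ᶜ)ᶜ := by rw [s_compl, compl_compl]
    have h' : s σ (⊥ᶜ : A) = s σ (⊥ᶜ ⊔ ⊥) := by rw [sup_bot_eq]
    rw [h, h', s_sup, s_compl, compl_sup_eq_top, compl_top]

/-- The canonical frame of an algebra: its points, with the relations dual to the operations. -/
noncomputable def canonicalFrame (α : Type v) (A : Type u) [BooleanAlgebra A] [CPEA α A] :
    Frame α (Point A) where
  r i u v := ∀ x, u (c i x) ↔ v (c i x)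
  act σ u := u.comp (sHom A σ)
  e i j u := u (d i j)
  r_equiv i := ⟨fun _ _ => Iff.rfl, fun h x => (h x).symm, fun h h' x => (h x).trans (h' x)⟩
  act_id u := by
    ext x
    change u (s id x) ↔ u x
    rw [s_id]
  act_comp σ τ u := by
    ext x
    change u (s (σ ∘ τ) x) ↔ u (s σ (s τ x))
    rw [s_s]
  r_act_congr σ τ i u hστ x := by
    change u (s σ (c i x)) ↔ u (s τ (c i x))
    rw [s_c_congr σ τ i x hστ]
  r_act σ i j u v hσ huv x := by
    change u (s σ (c j x)) ↔ v (s σ (c j x))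
    rw [← s_c_closed σ i j x hσ]
    exact huv _
  act_eq σ i u v hσ huv := by
    ext x
    change u (s σ x) ↔ v (s σ x)
    rw [← c_s_empty σ i x hσ]
    exact huv _
  e_self i u := by
    rw [d_self]
    exact u.map_top_iff
  act_replacement i j u hu := Eq.symm <| Point.ext_of_imp
    (v := u.comp (sHom A (replacement i j))) fun x hx =>
      u.mono (inf_d_le i j x) ((u.map_inf_iff _ _).2 ⟨hx, hu⟩)
  e_act τ i j u := by
    change u (s τ (d i j)) ↔ u (d (τ i) (τ j))
    rw [s_d]

/-- The `i`-closed elements are closed under complement, so inclusion on them already gives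
agreement. -/
theorem r_canonicalFrame_of_imp {i : α} {u v : Point A} (huv : ∀ x, u (c i x) → v (c i x)) :
    (canonicalFrame α A).r i u v := by
  refine fun x => ⟨huv x, fun hv => ?_⟩
  by_contra hu
  have := huv (c i x)ᶜ
  rw [c_compl_c, u.map_compl_iff, v.map_compl_iff] at this
  exact this hu hv

/-- The existence lemma for cylindrifications. -/
theorem point_c_iff (i : α) (u : Point A) (x : A) :
    u (c i x) ↔ ∃ v, (canonicalFrame α A).r i u v ∧ v x := by
  refine ⟨fun hu => ?_, fun ⟨v, huv, hv⟩ => (huv x).2 (v.mono (le_c i x) hv)⟩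
  -- The filter is generated by `x` and the `i`-closed elements of `u`. It is proper: `x ⊓ c i z =
  -- ⊥` would give `c i x ⊓ c i z = ⊥` inside `u`.
  obtain ⟨v, hvF, -⟩ := Point.exists_separating {y | ∃ z, u (c i z) ∧ x ⊓ c i z ≤ y} {⊥}
    ⟨x, hu, le_top⟩ (fun y y' hy ⟨z, hz, hzy⟩ => ⟨z, hz, hzy.trans hy⟩)
    (fun y y' ⟨z, hz, hzy⟩ ⟨z', hz', hzy'⟩ => ⟨z ⊓ c i z', by
      rw [c_inf_c, u.map_inf_iff]; exact ⟨hz, hz'⟩, by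
      rw [c_inf_c, inf_inf_distrib_left]; exact inf_le_inf hzy hzy'⟩)
    rfl (fun y y' hy hy' => le_bot_iff.1 (hy.trans (le_of_eq hy')))
    (fun y y' hy hy' => by rw [hy, hy']; exact sup_bot_eq _) (by
      rintro y ⟨z, hz, hzy⟩ rfl
      have hbot : u (c i (x ⊓ c i z)) := by
        rw [c_inf_c, u.map_inf_iff]; exact ⟨hu, hz⟩
      rw [le_bot_iff.1 hzy, c_bot] at hbot
      exact u.not_map_bot hbot)
  exact ⟨v, r_canonicalFrame_of_imp fun z hz => hvF _ ⟨z, hz, inf_le_right⟩,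
    hvF _ ⟨x, hu, inf_le_left⟩⟩

end CPEA

/-! ### Dual maps and the pullback amalgam -/

namespace CPEAHom

open CPEA

variable {α : Type v} {A B C : Type u} [BooleanAlgebra A] [BooleanAlgebra B] [BooleanAlgebra C]
  [CPEA α A] [CPEA α B] [CPEA α C]

/-- The map of canonical frames dual to a homomorphism. -/
noncomputable def dual (f : CPEAHom α A B) (u : Point B) : Point A := u.comp f.toBoundedLatticeHom

theorem dual_apply (f : CPEAHom α A B) (u : Point B) (a : A) : f.dual u a = u (f.toFun a) := rfl

theorem dual_r (f : CPEAHom α A B) {i : α} {u v : Point B}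
    (huv : (canonicalFrame α B).r i u v) : (canonicalFrame α A).r i (f.dual u) (f.dual v) := by
  intro a
  rw [dual_apply, dual_apply, f.map_c]
  exact huv _

theorem dual_act (f : CPEAHom α A B) (σ : α → α) (u : Point B) :
    f.dual ((canonicalFrame α B).act σ u) = (canonicalFrame α A).act σ (f.dual u) := by
  ext a
  change u (s σ (f.toFun a)) ↔ u (f.toFun (s σ a))
  rw [f.map_s]

theorem dual_e (f : CPEAHom α A B) (i j : α) (u : Point B) :
    (canonicalFrame α A).e i j (f.dual u) ↔ (canonicalFrame α B).e i j u := by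
  change u (f.toFun (d i j)) ↔ u (d i j)
  rw [f.map_d]

/-- The back condition for the dual of a homomorphism. -/
theorem exists_r_dual_eq (f : CPEAHom α A B) {i : α} {u : Point B} {w : Point A}
    (hw : (canonicalFrame α A).r i (f.dual u) w) :
    ∃ v, (canonicalFrame α B).r i u v ∧ f.dual v = w := by
  -- It suffices to lift `w` to a point containing the `i`-closed elements of `u`. If such an
  -- element lay below `f a` with `a` outside `w`, it would be disjoint from the cylindrification of
  -- `(f a)ᶜ`, which is also in `u`.
  obtain ⟨v, hvF, hvw⟩ := Point.exists_lift f.toBoundedLatticeHom w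
    {y | ∃ z, u (c i z) ∧ c i z ≤ y}
    ⟨⊤, u.mono (le_c i ⊤) u.map_top_iff, le_top⟩
    (fun y y' hy ⟨z, hz, hzy⟩ => ⟨z, hz, hzy.trans hy⟩)
    (fun y y' ⟨z, hz, hzy⟩ ⟨z', hz', hzy'⟩ => ⟨z ⊓ c i z', by
      rw [c_inf_c, u.map_inf_iff]; exact ⟨hz, hz'⟩, by
      rw [c_inf_c]; exact inf_le_inf hzy hzy'⟩) (by
      rintro a ⟨z, hz, hza⟩
      by_contra hwa
      have hu : u (f.toFun (c i aᶜ)) :=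
        (hw aᶜ).2 (w.mono (le_c i aᶜ) ((w.map_compl_iff a).2 hwa))
      have hcompl : f.toFun aᶜ = (f.toFun a)ᶜ := map_compl' f.toBoundedLatticeHom a
      have hdisj : (f.toFun a)ᶜ ⊓ c i z = ⊥ :=
        disjoint_iff.1 (disjoint_compl_left.mono_right hza)
      have hbot : u (c i ((f.toFun a)ᶜ ⊓ c i z)) := by
        rw [c_inf_c, u.map_inf_iff, ← hcompl, ← f.map_c]
        exact ⟨hu, hz⟩
      rw [hdisj, c_bot] at hbot
      exact u.not_map_bot hbot)
  exact ⟨v, r_canonicalFrame_of_imp fun z hz => hvF _ ⟨z, hz, le_rfl⟩, hvw⟩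

/-- Pairs of points of `B` and `C` that agree on `A`. -/
abbrev Pullback (f : CPEAHom α A B) (h : CPEAHom α A C) : Type u :=
  {p : Point B × Point C // f.dual p.1 = h.dual p.2}

/-- The pullback of the canonical frames of `B` and `C` over that of `A`. -/
noncomputable def pullbackFrame (f : CPEAHom α A B) (h : CPEAHom α A C) : Frame α (Pullback f h) where
  r i p q := (canonicalFrame α B).r i p.1.1 q.1.1 ∧ (canonicalFrame α C).r i p.1.2 q.1.2
  act σ p := ⟨((canonicalFrame α B).act σ p.1.1, (canonicalFrame α C).act σ p.1.2), by
    rw [dual_act, dual_act, p.2]⟩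
  -- The `C` coordinate gives the same predicate, since both are read off the common restriction to
  -- `A`.
  e i j p := (canonicalFrame α B).e i j p.1.1
  r_equiv i := ⟨fun _ => ⟨(Frame.r_equiv _ i).refl _, (Frame.r_equiv _ i).refl _⟩,
    fun h => ⟨(Frame.r_equiv _ i).symm h.1, (Frame.r_equiv _ i).symm h.2⟩,
    fun h h' => ⟨(Frame.r_equiv _ i).trans h.1 h'.1, (Frame.r_equiv _ i).trans h.2 h'.2⟩⟩
  act_id p := Subtype.ext (Prod.ext ((canonicalFrame α B).act_id _)
    ((canonicalFrame α C).act_id _))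
  act_comp σ τ p := Subtype.ext (Prod.ext ((canonicalFrame α B).act_comp σ τ _)
    ((canonicalFrame α C).act_comp σ τ _))
  r_act_congr σ τ i p hστ := ⟨(canonicalFrame α B).r_act_congr σ τ i _ hστ,
    (canonicalFrame α C).r_act_congr σ τ i _ hστ⟩
  r_act σ i j p q hσ hpq := ⟨(canonicalFrame α B).r_act σ i j _ _ hσ hpq.1,
    (canonicalFrame α C).r_act σ i j _ _ hσ hpq.2⟩
  act_eq σ i p q hσ hpq := Subtype.ext (Prod.ext
    ((canonicalFrame α B).act_eq σ i _ _ hσ hpq.1) ((canonicalFrame α C).act_eq σ i _ _ hσ hpq.2))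
  e_self i p := (canonicalFrame α B).e_self i _
  act_replacement i j p hp := Subtype.ext (Prod.ext
    ((canonicalFrame α B).act_replacement i j _ hp)
    ((canonicalFrame α C).act_replacement i j _ (by rwa [← h.dual_e, ← p.2, f.dual_e])))
  e_act τ i j p := (canonicalFrame α B).e_act τ i j _

/-- The embedding of `B` in the complex algebra of the pullback. -/
noncomputable def pullbackLeft (f : CPEAHom α A B) (h : CPEAHom α A C) :
    letI := (pullbackFrame f h).complexAlgebra
    CPEAHom α B (Set (Pullback f h)) :=
  letI := (pullbackFrame f h).complexAlgebra
  { toFun := fun x => {p | p.1.1 x}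
    map_sup' := fun x y => Set.ext fun p => p.1.1.map_sup_iff x y
    map_inf' := fun x y => Set.ext fun p => p.1.1.map_inf_iff x y
    map_top' := Set.eq_univ_of_forall fun p => p.1.1.map_top_iff
    map_bot' := Set.eq_empty_of_forall_notMem fun p => p.1.1.not_map_bot
    map_c := fun i x => by
      ext p
      refine (point_c_iff i p.1.1 x).trans ⟨fun ⟨u, hu, hux⟩ => ?_, fun ⟨q, hq, hqx⟩ =>
        ⟨q.1.1, hq.1, hqx⟩⟩
      -- The move from `p.1.1` to `u` is pushed down to `A` and lifted to `C` by the back condition,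
      -- which completes `u` to a pair.
      obtain ⟨v, hv, hvu⟩ := h.exists_r_dual_eq (p.2 ▸ f.dual_r hu)
      exact ⟨⟨(u, v), hvu.symm⟩, ⟨hu, hv⟩, hux⟩
    map_s := fun _ _ => rfl
    map_d := fun _ _ => rfl }

/-- The embedding of `C` in the complex algebra of the pullback. -/
noncomputable def pullbackRight (f : CPEAHom α A B) (h : CPEAHom α A C) :
    letI := (pullbackFrame f h).complexAlgebra
    CPEAHom α C (Set (Pullback f h)) :=
  letI := (pullbackFrame f h).complexAlgebra
  { toFun := fun x => {p | p.1.2 x}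
    map_sup' := fun x y => Set.ext fun p => p.1.2.map_sup_iff x y
    map_inf' := fun x y => Set.ext fun p => p.1.2.map_inf_iff x y
    map_top' := Set.eq_univ_of_forall fun p => p.1.2.map_top_iff
    map_bot' := Set.eq_empty_of_forall_notMem fun p => p.1.2.not_map_bot
    map_c := fun i x => by
      ext p
      refine (point_c_iff i p.1.2 x).trans ⟨fun ⟨v, hv, hvx⟩ => ?_, fun ⟨q, hq, hqx⟩ =>
        ⟨q.1.2, hq.2, hqx⟩⟩
      obtain ⟨u, hu, huv⟩ := f.exists_r_dual_eq (p.2 ▸ h.dual_r hv)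
      exact ⟨⟨(u, v), huv⟩, ⟨hu, hv⟩, hvx⟩
    map_s := fun _ _ => rfl
    map_d := fun i j => by
      ext p
      change (canonicalFrame α C).e i j p.1.2 ↔ (canonicalFrame α B).e i j p.1.1
      rw [← h.dual_e, ← p.2, f.dual_e] }

/-- Injectivity of `h` is what matters here: it lets every point of `B` be completed to a pair, and
points of `B` separate its elements. -/
theorem pullbackLeft_injective (f : CPEAHom α A B) (h : CPEAHom α A C)
    (hh : Function.Injective h.toFun) : Function.Injective (pullbackLeft f h).toFun := by
  have key : ∀ x y, (pullbackLeft f h).toFun x = (pullbackLeft f h).toFun y → x ≤ y := by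
    intro x y hxy
    by_contra hle
    obtain ⟨u, hux, huy⟩ := Point.exists_mem_of_not_le hle
    obtain ⟨v, hv⟩ := Point.exists_lift_of_injective h.toBoundedLatticeHom hh (f.dual u)
    exact huy ((Set.ext_iff.1 hxy ⟨(u, v), hv.symm⟩).1 hux)
  exact fun x y hxy => le_antisymm (key x y hxy) (key y x hxy.symm)

theorem pullbackRight_injective (f : CPEAHom α A B) (h : CPEAHom α A C)
    (hf : Function.Injective f.toFun) : Function.Injective (pullbackRight f h).toFun := by
  have key : ∀ x y, (pullbackRight f h).toFun x = (pullbackRight f h).toFun y → x ≤ y := by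
    intro x y hxy
    by_contra hle
    obtain ⟨v, hvx, hvy⟩ := Point.exists_mem_of_not_le hle
    obtain ⟨u, hu⟩ := Point.exists_lift_of_injective f.toBoundedLatticeHom hf (h.dual v)
    exact hvy ((Set.ext_iff.1 hxy ⟨(u, v), hu⟩).1 hvx)
  exact fun x y hxy => le_antisymm (key x y hxy) (key y x hxy.symm)

end CPEAHom

end CylPoly

open CylPoly CPEAHom in
theorem mainTheorem1 (α : Type v) : CylPoly.HasSUPAP.{u, v} α := by
  intro A B C _ _ _ _ _ _ f h hf hh
  refine ⟨Set (Pullback f h), inferInstance, (pullbackFrame f h).complexAlgebra,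
    pullbackLeft f h, pullbackRight f h, pullbackLeft_injective f h hh,
    pullbackRight_injective f h hf, fun a => ?_, fun x y hxy => ?_, fun x y hyx => ?_⟩
  · ext p
    exact iff_of_eq (DFunLike.congr_fun p.2 a)
  · exact Point.exists_interpolant f.toBoundedLatticeHom h.toBoundedLatticeHom x y
      fun u v huv hux => hxy (a := ⟨(u, v), huv⟩) hux
  · exact Point.exists_interpolant h.toBoundedLatticeHom f.toBoundedLatticeHom y x
      fun v u hvu hvy => hyx (a := ⟨(u, v), hvu.symm⟩) hvy
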